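/- Let $\mathbb{F}_q$ be a finite field with $q$ elements, let $n\ge 0$ and $r\ge 0$ be integers, and let $f:\mathbb{F}_q^n\to\mathbb{Z}$ be a function. Suppose that for every direction, i.e. for every one-dimensional linear subspace $W\subseteq\mathbb{F}_q^n$, there is a line $E$ in that direction, i.e. a translate $E=a+W$ with $a\in\mathbb{F}_q^n$, such that $$\sum_{x\in E}|f(x)|\ \ge\ r.$$ Then $$\sum_{x\in\mathbb{F}_q^n}|f(x)|^n\ \ge\ \frac{r^n}{(2-q^{-1})^n}$$ (for $n=0$, with the convention $t^0=1$ for all $t$). -/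

import Mathlib

/-- The lines of `F ^ n` in the direction `W` (a linear subspace of dimension one): the translates
`a + W` of `W`. -/
def IsLineInDirection {F : Type*} [Field F] {n : ℕ} (E : AffineSubspace F (Fin n → F))
    (W : Submodule F (Fin n → F)) : Prop :=
  Module.finrank F W = 1 ∧ (E : Set (Fin n → F)).Nonempty ∧ E.direction = W

/-! This is the polynomial method with multiplicities. Let `q = |F|`. If the bound fails, then for
large `N` counting dimensions gives a nonzero `P` of degree less than `N q r` vanishing at each `x`
to order `N (2q - 1) |f x|` (`exists_ne_zero_vanishesAt`). The factor `N` makes the lower-order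
terms of the count negligible.

Let `D` be the degree of `P` and `H` its leading form. On a rich line `u + T v`, the coefficient of
`Y ^ α` in `P (u + T v + Y)` is a polynomial in `T` of degree at most `D - |α|` with many prescribed
roots, so it vanishes for `|α| ≤ D / q`. Its coefficient at `T ^ (D - |α|)` is the coefficient of `Y
^ α` in `H (v + Y)`. Hence `H` vanishes to order `D / q + 1` at every direction `v`
(`vanishesAt_leadingForm`), which contradicts the Schwartz–Zippel bound with multiplicities
(`card_mul_le_totalDegree`). -/

open MvPolynomial in
/-- The translate `P (Y + x)` of a multivariate polynomial `P`. -/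
noncomputable def MvPolynomial.translate {F σ : Type*} [CommRing F] (x : σ → F) :
    MvPolynomial σ F →ₐ[F] MvPolynomial σ F :=
  aeval fun i => X i + C (x i)

/-- `P` vanishes at `x` to order at least `k`. -/
def MvPolynomial.VanishesAt {F σ : Type*} [CommRing F] (P : MvPolynomial σ F) (x : σ → F)
    (k : ℕ) : Prop :=
  ∀ α : σ →₀ ℕ, α.degree < k → (translate x P).coeff α = 0

/-- `Q` lies in the `k`-th power of the ideal generated by the variables and `T - b`, where `T` is
the variable of the coefficient ring. -/
def MvPolynomial.VanishesAlong {F σ : Type*} [CommRing F] (b : F) (k : ℕ)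
    (Q : MvPolynomial σ (Polynomial F)) : Prop :=
  ∀ α : σ →₀ ℕ, (Polynomial.X - Polynomial.C b) ^ (k - α.degree) ∣ Q.coeff α

/-- Every monomial `Y ^ α * T ^ j` of `Q` satisfies `|α| + j ≤ d`, and those with equality sum up to
the homogenization of `h`. -/
def MvPolynomial.HasTopForm {F σ : Type*} [CommRing F] (d : ℕ)
    (Q : MvPolynomial σ (Polynomial F)) (h : MvPolynomial σ F) : Prop :=
  ∀ α : σ →₀ ℕ, (α.degree ≤ d → (Q.coeff α).natDegree ≤ d - α.degree ∧
      (Q.coeff α).coeff (d - α.degree) = h.coeff α) ∧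
    (d < α.degree → Q.coeff α = 0 ∧ h.coeff α = 0)

namespace MvPolynomial

/-! ### Orders of vanishing over the coefficient ring `F[T]`. -/

section VanishesAlong

variable {F σ : Type*} [CommRing F] {b : F} {k l : ℕ} {Q R : MvPolynomial σ (Polynomial F)}

theorem VanishesAlong.mono (hQ : VanishesAlong b k Q) (h : l ≤ k) : VanishesAlong b l Q :=
  fun α => (pow_dvd_pow _ (by omega)).trans (hQ α)

theorem vanishesAlong_zero_order (Q : MvPolynomial σ (Polynomial F)) : VanishesAlong b 0 Q := by
  intro α
  simp

theorem VanishesAlong.mul (hQ : VanishesAlong b k Q) (hR : VanishesAlong b l R) :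
    VanishesAlong b (k + l) (Q * R) := by
  classical
  intro α
  rw [coeff_mul]
  refine Finset.dvd_sum fun p hp => ?_
  have hdeg : p.1.degree + p.2.degree = α.degree := by
    rw [← Finset.HasAntidiagonal.mem_antidiagonal.1 hp, map_add]
  have h := mul_dvd_mul (hQ p.1) (hR p.2)
  rw [← pow_add] at h
  exact (pow_dvd_pow _ (by omega)).trans h

theorem VanishesAlong.pow (hQ : VanishesAlong b k Q) (m : ℕ) :
    VanishesAlong b (m * k) (Q ^ m) := by
  induction m with
  | zero => simpa using vanishesAlong_zero_order _
  | succ m ih => rw [pow_succ, Nat.succ_mul]; exact ih.mul hQ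

theorem VanishesAlong.prod {τ : Type*} (s : Finset τ) (m : τ → ℕ)
    (g : τ → MvPolynomial σ (Polynomial F)) (hg : ∀ i ∈ s, VanishesAlong b (m i) (g i)) :
    VanishesAlong b (∑ i ∈ s, m i) (∏ i ∈ s, g i) := by
  classical
  induction s using Finset.induction_on with
  | empty => simpa using vanishesAlong_zero_order _
  | insert i s his ih =>
    rw [Finset.sum_insert his, Finset.prod_insert his]
    exact (hg i (by simp)).mul (ih fun j hj => hg j (by simp [hj]))

theorem VanishesAlong.sum {τ : Type*} (s : Finset τ) (g : τ → MvPolynomial σ (Polynomial F))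
    (hg : ∀ i ∈ s, VanishesAlong b k (g i)) : VanishesAlong b k (∑ i ∈ s, g i) := by
  intro α
  rw [coeff_sum]
  exact Finset.dvd_sum fun i hi => hg i hi α

theorem vanishesAlong_X (i : σ) : VanishesAlong b 1 (X i : MvPolynomial σ (Polynomial F)) := by
  classical
  intro α
  rw [coeff_X]
  split_ifs with h
  · simp [← h]
  · simp

theorem vanishesAlong_C_mul (p : Polynomial F) :
    VanishesAlong b 1 (C (p * (Polynomial.X - Polynomial.C b)) :
      MvPolynomial σ (Polynomial F)) := by
  classical
  intro α
  rw [coeff_C]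
  split_ifs with h
  · simp [← h]
  · simp

theorem VanishesAlong.add (hQ : VanishesAlong b k Q) (hR : VanishesAlong b k R) :
    VanishesAlong b k (Q + R) := by
  intro α
  rw [coeff_add]
  exact dvd_add (hQ α) (hR α)

/-- Substituting elements of an ideal into a polynomial with no terms of degree below `k` lands in
the `k`-th power of the ideal. -/
theorem VanishesAlong.aeval {τ : Type*} {g : τ → MvPolynomial σ (Polynomial F)}
    (hg : ∀ i, VanishesAlong b 1 (g i)) {P : MvPolynomial τ F}
    (hP : ∀ α : τ →₀ ℕ, α.degree < k → P.coeff α = 0) :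
    VanishesAlong b k (MvPolynomial.aeval g P) := by
  rw [aeval_def, eval₂_eq]
  refine VanishesAlong.sum _ _ fun α hα => ?_
  have hk : k ≤ α.degree := by
    by_contra h
    exact mem_support_iff.1 hα (hP α (not_le.1 h))
  have h := VanishesAlong.prod α.support (fun i => α i * 1) (fun i => g i ^ α i)
    fun i _ => (hg i).pow (α i)
  have h2 := ((vanishesAlong_zero_order (b := b)
    (algebraMap F (MvPolynomial σ (Polynomial F)) (P.coeff α))).mul h)
  refine h2.mono ?_
  simpa [Finsupp.degree_apply] using hk

end VanishesAlong

theorem eq_zero_of_forall_pow_dvd {F : Type*} [Field F] [Fintype F] {g : Polynomial F}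
    (m : F → ℕ) (hg : ∀ b, (Polynomial.X - Polynomial.C b) ^ m b ∣ g)
    (hdeg : g.natDegree < ∑ b, m b) : g = 0 := by
  have hdvd : ∏ b, (Polynomial.X - Polynomial.C b) ^ m b ∣ g := by
    refine Finset.prod_dvd_of_coprime ?_ fun b _ => hg b
    intro b _ c _ hbc
    exact (Polynomial.pairwise_coprime_X_sub_C (Function.injective_id (α := F)) hbc).pow
  refine Polynomial.eq_zero_of_dvd_of_natDegree_lt hdvd ?_
  rw [Polynomial.natDegree_prod_of_monic _ _ fun b _ => (Polynomial.monic_X_sub_C b).pow _]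
  simpa using hdeg

/-! ### Top-degree parts. -/

section HasTopForm

variable {F σ : Type*} [CommRing F] {d e : ℕ} {Q R : MvPolynomial σ (Polynomial F)}
  {g h : MvPolynomial σ F}

theorem HasTopForm.mul (hQ : HasTopForm d Q g) (hR : HasTopForm e R h) :
    HasTopForm (d + e) (Q * R) (g * h) := by
  classical
  have hadd : ∀ {α : σ →₀ ℕ} {p : (σ →₀ ℕ) × (σ →₀ ℕ)}, p ∈ Finset.HasAntidiagonal.antidiagonal α →
      p.1.degree + p.2.degree = α.degree := fun hp => by
    rw [← Finset.HasAntidiagonal.mem_antidiagonal.1 hp, map_add]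
  intro α
  rw [coeff_mul, coeff_mul]
  refine ⟨fun hα => ⟨Polynomial.natDegree_sum_le_of_forall_le _ _ fun p hp => ?_, ?_⟩,
    fun hα => ⟨Finset.sum_eq_zero fun p hp => ?_, Finset.sum_eq_zero fun p hp => ?_⟩⟩
  · have := hadd hp
    rcases lt_or_ge d p.1.degree with h1 | h1
    · simp [((hQ p.1).2 h1).1]
    rcases lt_or_ge e p.2.degree with h2 | h2
    · simp [((hR p.2).2 h2).1]
    have a1 := ((hQ p.1).1 h1).1
    have a2 := ((hR p.2).1 h2).1
    exact Polynomial.natDegree_mul_le.trans (by omega)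
  · rw [Polynomial.finsetSum_coeff]
    refine Finset.sum_congr rfl fun p hp => ?_
    have := hadd hp
    rcases lt_or_ge d p.1.degree with h1 | h1
    · simp [(hQ p.1).2 h1]
    rcases lt_or_ge e p.2.degree with h2 | h2
    · simp [(hR p.2).2 h2]
    have a1 := (hQ p.1).1 h1
    have a2 := (hR p.2).1 h2
    rw [show d + e - α.degree = (d - p.1.degree) + (e - p.2.degree) by omega,
      Polynomial.coeff_mul_add_eq_of_natDegree_le a1.1 a2.1, a1.2, a2.2]
  · have := hadd hp
    rcases lt_or_ge d p.1.degree with h1 | h1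
    · simp [(hQ p.1).2 h1]
    · simp [(hR p.2).2 (by omega)]
  · have := hadd hp
    rcases lt_or_ge d p.1.degree with h1 | h1
    · simp [(hQ p.1).2 h1]
    · simp [(hR p.2).2 (by omega)]

theorem hasTopForm_C (c : F) : HasTopForm 0 (C (Polynomial.C c) : MvPolynomial σ _) (C c) := by
  classical
  intro α
  rw [coeff_C, coeff_C]
  refine ⟨fun _ => ?_, fun hα => ?_⟩
  · split_ifs <;> simp
  · have : 0 ≠ α := by rintro rfl; simp at hα
    simp [this]

theorem HasTopForm.pow (hQ : HasTopForm d Q g) (m : ℕ) : HasTopForm (m * d) (Q ^ m) (g ^ m) := by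
  induction m with
  | zero => simpa using hasTopForm_C (1 : F)
  | succ m ih => rw [pow_succ, pow_succ, Nat.succ_mul]; exact ih.mul hQ

theorem HasTopForm.prod {τ : Type*} (s : Finset τ) (m : τ → ℕ)
    (Q : τ → MvPolynomial σ (Polynomial F)) (g : τ → MvPolynomial σ F)
    (hg : ∀ i ∈ s, HasTopForm (m i) (Q i) (g i)) :
    HasTopForm (∑ i ∈ s, m i) (∏ i ∈ s, Q i) (∏ i ∈ s, g i) := by
  classical
  induction s using Finset.induction_on with
  | empty => simpa using hasTopForm_C (1 : F)
  | insert i s his ih =>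
    rw [Finset.sum_insert his, Finset.prod_insert his, Finset.prod_insert his]
    exact (hg i (by simp)).mul (ih fun j hj => hg j (by simp [hj]))

theorem HasTopForm.sum {τ : Type*} (s : Finset τ)
    (Q : τ → MvPolynomial σ (Polynomial F)) (g : τ → MvPolynomial σ F)
    (hg : ∀ i ∈ s, HasTopForm d (Q i) (g i)) :
    HasTopForm d (∑ i ∈ s, Q i) (∑ i ∈ s, g i) := by
  intro α
  simp only [coeff_sum, Polynomial.finsetSum_coeff]
  exact ⟨fun hα => ⟨Polynomial.natDegree_sum_le_of_forall_le _ _ fun i hi => ((hg i hi α).1 hα).1,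
      Finset.sum_congr rfl fun i hi => ((hg i hi α).1 hα).2⟩,
    fun hα => ⟨Finset.sum_eq_zero fun i hi => ((hg i hi α).2 hα).1,
      Finset.sum_eq_zero fun i hi => ((hg i hi α).2 hα).2⟩⟩

/-- This discards the monomials of `P` below degree `d`, which do not affect the part of degree `d`.
-/
theorem HasTopForm.of_lt (hQ : HasTopForm e Q g) (h : e < d) : HasTopForm d Q 0 := by
  intro α
  refine ⟨fun hα => ?_, fun hα => ⟨((hQ α).2 (by omega)).1, by simp⟩⟩
  rcases lt_or_ge e α.degree with h1 | h1
  · simp [((hQ α).2 h1).1]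
  · have := ((hQ α).1 h1).1
    exact ⟨by omega, by rw [coeff_zero]; exact Polynomial.coeff_eq_zero_of_natDegree_lt (by omega)⟩

theorem hasTopForm_linear (u v : F) (i : σ) :
    HasTopForm 1 (X i + C (Polynomial.C u + Polynomial.C v * Polynomial.X))
      (X i + C v : MvPolynomial σ F) := by
  classical
  intro α
  rw [coeff_add, coeff_add, coeff_C, coeff_C, coeff_X, coeff_X]
  rcases eq_or_ne α 0 with rfl | h0
  · have h1 : Finsupp.single i 1 ≠ 0 := by simp
    simp only [h1, if_false, if_true, map_zero, zero_add, zero_le, true_imp_iff, not_lt_zero,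
      false_imp_iff, and_true, Nat.sub_zero, Polynomial.coeff_add]
    refine ⟨?_, by simp [Polynomial.coeff_C]⟩
    compute_degree
  · have h0' : 0 ≠ α := h0.symm
    have h1 : 1 ≤ α.degree := Nat.one_le_iff_ne_zero.2 (mt (Finsupp.degree_eq_zero_iff α).1 h0)
    simp only [h0', if_false, add_zero]
    refine ⟨fun h => ?_, fun h => ?_⟩
    · split_ifs <;> simp [le_antisymm h h1, Polynomial.coeff_one]
    · have : Finsupp.single i 1 ≠ α := by rintro rfl; simp at h
      simp [this]

/-- The part of top degree of `P (u + T * v + Y)` is given by the leading form of `P`. -/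
theorem hasTopForm_aeval (u v : σ → F) {P : MvPolynomial σ F} (hP : P.totalDegree ≤ d) :
    HasTopForm d
      (aeval (fun i => X i + C (Polynomial.C (u i) + Polynomial.C (v i) * Polynomial.X)) P)
      (translate v (homogeneousComponent d P)) := by
  classical
  set G : σ → MvPolynomial σ (Polynomial F) :=
    fun i => X i + C (Polynomial.C (u i) + Polynomial.C (v i) * Polynomial.X) with hG
  rw [homogeneousComponent_apply, map_sum, Finset.sum_filter, aeval_def, eval₂_eq]
  refine HasTopForm.sum _ _ _ fun α hα => ?_
  have hle : α.degree ≤ d := by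
    refine le_trans ?_ hP
    simpa [Finsupp.degree_apply, Finsupp.sum] using le_totalDegree hα
  have hmon : HasTopForm α.degree (algebraMap F (MvPolynomial σ (Polynomial F)) (P.coeff α) *
      ∏ i ∈ α.support, G i ^ α i) (translate v (monomial α (P.coeff α))) := by
    have h := (hasTopForm_C (σ := σ) (P.coeff α)).mul (HasTopForm.prod α.support
      (fun i => α i * 1) (fun i => G i ^ α i) (fun i => (X i + C (v i)) ^ α i)
      fun i _ => (hasTopForm_linear (u i) (v i) i).pow (α i))
    rw [translate, aeval_monomial]
    simpa [Finsupp.degree_apply, Finsupp.prod] using h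
  split_ifs with h
  · exact h ▸ hmon
  · exact hmon.of_lt (lt_of_le_of_ne hle h)

end HasTopForm

end MvPolynomial

namespace MvPolynomial

/-! ### Schwartz–Zippel with multiplicities. -/

section SchwartzZippel

variable {F : Type*} [Field F]

/-- The substitution `X₀ ↦ T`, `Xᵢ₊₁ ↦ Yᵢ + aᵢ`, in terms of the coefficients of `X₀ ^ j`. -/
theorem aeval_cons_translate {n : ℕ} (a : Fin n → F) (P : MvPolynomial (Fin (n + 1)) F) :
    aeval (Fin.cons (C Polynomial.X) fun i => X i + C (Polynomial.C (a i)) :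
      Fin (n + 1) → MvPolynomial (Fin n) (Polynomial F)) P =
    Polynomial.eval₂ ((map Polynomial.C).comp (translate a).toRingHom) (C Polynomial.X)
      (finSuccEquiv F n P) := by
  induction P using MvPolynomial.induction_on with
  | C c =>
    simp [finSuccEquiv_apply]
  | add p q hp hq => rw [map_add, map_add, Polynomial.eval₂_add, hp, hq]
  | mul_X p i hp =>
    rw [map_mul, map_mul, Polynomial.eval₂_mul, hp]
    congr 1
    refine Fin.cases ?_ (fun j => ?_) i
    · simp [finSuccEquiv_apply]
    · simp [finSuccEquiv_apply, translate]

theorem coeff_coeff_aeval_cons {n : ℕ} (a : Fin n → F) (P : MvPolynomial (Fin (n + 1)) F)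
    (α : Fin n →₀ ℕ) (j : ℕ) :
    ((aeval (Fin.cons (C Polynomial.X) fun i => X i + C (Polynomial.C (a i)) :
      Fin (n + 1) → MvPolynomial (Fin n) (Polynomial F)) P).coeff α).coeff j =
    (translate a ((finSuccEquiv F n P).coeff j)).coeff α := by
  rw [aeval_cons_translate, Polynomial.eval₂_eq_sum_range, coeff_sum, Polynomial.finsetSum_coeff]
  simp only [← C_pow, mul_comm _ (C (Polynomial.X ^ _)), coeff_C_mul]
  simp only [RingHom.comp_apply, coeff_map, mul_comm (Polynomial.X ^ _), Polynomial.coeff_C_mul, Polynomial.coeff_X_pow]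
  simp only [mul_ite, mul_one, mul_zero, Finset.sum_ite_eq, Finset.mem_range]
  split_ifs with h
  · rfl
  · rw [Polynomial.coeff_eq_zero_of_natDegree_lt (by omega)]
    simp

/-- A nonzero polynomial which vanishes to order `M` at all points of `F ^ n` has degree at least
`|F| * M`. -/
theorem card_mul_le_totalDegree [Fintype F] {n : ℕ} {P : MvPolynomial (Fin n) F} (hP : P ≠ 0)
    {M : ℕ} (hM : ∀ a, P.VanishesAt a M) : Fintype.card F * M ≤ P.totalDegree := by
  induction n generalizing M with
  | zero =>
    suffices M = 0 by simp [this]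
    by_contra h
    have h0 := hM 0 0 (by simpa using Nat.pos_of_ne_zero h)
    rw [eq_C_of_isEmpty P] at h0 hP
    apply hP
    simpa [translate] using h0
  | succ n ih =>
    set q := Fintype.card F with hq
    have hq0 : 0 < q := Fintype.card_pos
    set t := (finSuccEquiv F n P).natDegree with ht
    have hlead : (finSuccEquiv F n P).coeff t ≠ 0 := by
      simpa [ht] using hP
    have hdeg := totalDegree_coeff_finSuccEquiv_add_le P t hlead
    -- Induction applies to the leading coefficient in `X₀`. If `|α| < M - t / q`, the coefficient
    -- of `Y ^ α` in `P (T, Y + a)` has degree at most `t` in `T`, yet `(T - b) ^ (M - |α|)` divides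
    -- it for all `q` values of `b`, and `q (M - |α|) > t`.
    have key := ih hlead (M := M - t / q) fun a α hα => by
      rw [← coeff_coeff_aeval_cons]
      set Q := aeval (Fin.cons (C Polynomial.X) fun i => X i + C (Polynomial.C (a i)) :
        Fin (n + 1) → MvPolynomial (Fin n) (Polynomial F)) P with hQ
      have hvan : ∀ b, VanishesAlong b M Q := fun b => by
        have h := VanishesAlong.aeval (σ := Fin n) (b := b)
          (g := Fin.cons (C (1 * (Polynomial.X - Polynomial.C b))) X)
          (fun i => Fin.cases (vanishesAlong_C_mul _) (fun j => vanishesAlong_X _) i)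
          (hM (Fin.cons b a))
        have heq : aeval (Fin.cons (C (1 * (Polynomial.X - Polynomial.C b))) X :
            Fin (n + 1) → MvPolynomial (Fin n) (Polynomial F)) (translate (Fin.cons b a) P)
            = Q := by
          rw [hQ, ← AlgHom.comp_apply]
          congr 1
          refine algHom_ext fun i => Fin.cases ?_ (fun j => ?_) i
          · simp [translate]
          · simp [translate]
        rwa [heq] at h
      have hnat : (Q.coeff α).natDegree ≤ t := by
        rw [Polynomial.natDegree_le_iff_coeff_eq_zero]
        intro j hj
        rw [hQ, coeff_coeff_aeval_cons, Polynomial.coeff_eq_zero_of_natDegree_lt hj]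
        simp
      have hz : Q.coeff α = 0 := by
        refine eq_zero_of_forall_pow_dvd (fun _ => M - α.degree) (fun b => hvan b α) ?_
        rw [Finset.sum_const, Finset.card_univ, smul_eq_mul]
        calc _ ≤ t := hnat
          _ < q * (t / q + 1) := Nat.lt_mul_div_succ t hq0
          _ ≤ _ := Nat.mul_le_mul_left _ (by omega)
      simp [hz]
    rw [Nat.mul_sub] at key
    have := Nat.mul_div_le t q
    omega

end SchwartzZippel

theorem homogeneousComponent_totalDegree_ne_zero {F σ : Type*} [CommRing F]
    {P : MvPolynomial σ F} (hP : P ≠ 0) : homogeneousComponent P.totalDegree P ≠ 0 := by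
  obtain ⟨α, hα, h⟩ := Finset.exists_mem_eq_sup P.support (support_nonempty.2 hP)
    fun s => s.sum fun _ e => e
  intro h0
  have := congrArg (coeff α) h0
  rw [coeff_homogeneousComponent, if_pos, coeff_zero] at this
  · exact mem_support_iff.1 hα this
  · rw [totalDegree, h]
    rfl

/-! ### Restriction to lines and the leading form. -/

section Lines

variable {F : Type*} [Field F] {n : ℕ}

theorem VanishesAt.vanishesAlong_line {P : MvPolynomial (Fin n) F} {u v : Fin n → F} {t : F}
    {k : ℕ} (h : P.VanishesAt (u + t • v) k) :
    VanishesAlong t k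
      (aeval (fun i => X i + C (Polynomial.C (u i) + Polynomial.C (v i) * Polynomial.X)) P) := by
  have h1 := VanishesAlong.aeval (σ := Fin n) (b := t)
    (g := fun i => X i + C (Polynomial.C (v i) * (Polynomial.X - Polynomial.C t)))
    (fun i => (vanishesAlong_X i).add (vanishesAlong_C_mul _)) h
  rw [translate, ← AlgHom.comp_apply] at h1
  convert h1 using 2
  refine algHom_ext fun i => ?_
  simp only [AlgHom.comp_apply, aeval_X, map_add, aeval_C, map_mul, map_sub,
    Pi.add_apply, Pi.smul_apply, smul_eq_mul]
  have halg : ∀ c : F, algebraMap F (MvPolynomial (Fin n) (Polynomial F)) c =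
      C (Polynomial.C c) := fun _ => rfl
  rw [halg, halg, halg]
  ring

variable [Fintype F]

/-- If `P` has degree at most `d` and its orders of vanishing along a line in the direction `v` are large,
then its form of degree `d` vanishes at `v` to high order. -/
theorem vanishesAt_leadingForm {P : MvPolynomial (Fin n) F} {d M : ℕ} (hd : P.totalDegree ≤ d)
    {u v : Fin n → F} (k : F → ℕ) (hk : ∀ t, P.VanishesAt (u + t • v) (k t))
    (hM : ∀ w < M, w ≤ d ∧ d - w + Fintype.card F * w < ∑ t, k t) :
    (homogeneousComponent d P).VanishesAt v M := by
  intro α hα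
  obtain ⟨hwd, hlt⟩ := hM _ hα
  have htop := (hasTopForm_aeval u v hd α).1 hwd
  rw [← htop.2]
  suffices h : coeff α (aeval (fun i => X i + C (Polynomial.C (u i) +
      Polynomial.C (v i) * Polynomial.X)) P : MvPolynomial (Fin n) (Polynomial F)) = 0 by
    rw [h, Polynomial.coeff_zero]
  refine eq_zero_of_forall_pow_dvd (fun t => k t - α.degree)
    (fun t => (hk t).vanishesAlong_line α) (lt_of_le_of_lt htop.1 ?_)
  have : ∑ t, k t ≤ ∑ t : F, ((k t - α.degree) + α.degree) :=
    Finset.sum_le_sum fun t _ => by omega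
  rw [Finset.sum_add_distrib, Finset.sum_const, Finset.card_univ, smul_eq_mul] at this
  omega

/-- There is no nonzero polynomial of small degree whose orders of vanishing have large sums along
a line in every direction. -/
theorem eq_zero_of_vanishesAt_lines [NeZero n] {P : MvPolynomial (Fin n) F} {d : ℕ}
    (hd : P.totalDegree ≤ d) (k : (Fin n → F) → ℕ) (hk : ∀ x, P.VanishesAt x (k x))
    (hlines : ∀ v : Fin n → F, v ≠ 0 → ∃ u, d * (2 * Fintype.card F - 1) <
      Fintype.card F * ∑ t : F, k (u + t • v)) : P = 0 := by
  by_contra hP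
  set q := Fintype.card F with hq
  have hq1 : 1 < q := Fintype.one_lt_card
  set D := P.totalDegree with hD
  have hH := homogeneousComponent_totalDegree_ne_zero hP
  rw [← hD] at hH
  have hhom := homogeneousComponent_isHomogeneous D P
  have hv : ∀ v : Fin n → F, v ≠ 0 → (homogeneousComponent D P).VanishesAt v (D / q + 1) := by
    intro v hv
    obtain ⟨u, hu⟩ := hlines v hv
    refine vanishesAt_leadingForm le_rfl (fun t => k (u + t • v)) (fun t => hk _) fun w hw => ?_
    have hw1 : q * w ≤ D :=
      (Nat.mul_le_mul_left q (Nat.lt_succ_iff.1 hw)).trans (Nat.mul_div_le D q)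
    have hwD : w ≤ D := (Nat.le_mul_of_pos_left w (by omega)).trans hw1
    refine ⟨hwD, ?_⟩
    -- The constant `2 - 1/q` arises here: `q w ≤ D` gives `q (D + (q - 1) w) ≤ (2q - 1) D`.
    refine Nat.lt_of_mul_lt_mul_left (a := q) (lt_of_le_of_lt ?_ hu)
    refine le_trans ?_ (Nat.mul_le_mul_right _ hd)
    rw [← hD, ← hq]
    zify [hwD, (by omega : 1 ≤ 2 * q)]
    zify at hw1 hq1
    nlinarith [mul_nonneg (sub_nonneg.2 hq1.le) (sub_nonneg.2 hw1)]
  have hall : ∀ v, (homogeneousComponent D P).VanishesAt v (D / q + 1) := by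
    intro v
    -- The origin is not a direction, but a form of degree `D` vanishes there to order `D ≥ D / q +
    -- 1` unless `D = 0`. A constant form is zero because it vanishes at the direction `1`.
    by_cases h0 : v = 0
    · subst h0
      intro α hα
      have htr : translate (0 : Fin n → F) = AlgHom.id F _ := by
        refine algHom_ext fun i => ?_
        simp [translate]
      rw [htr, AlgHom.id_apply]
      refine hhom.coeff_eq_zero fun hαD => ?_
      have hD0 : D = 0 := by
        by_contra h
        have := Nat.div_lt_self (Nat.pos_of_ne_zero h) hq1
        omega
      have hone : (1 : Fin n → F) ≠ 0 := fun h => one_ne_zero (congrFun h 0)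
      have h1 := hv 1 hone 0 (by simp)
      rw [hD0] at h1 hH
      rw [homogeneousComponent_zero] at h1 hH
      simp [translate] at h1
      simp [h1] at hH
    · exact hv v h0
  have h1 := card_mul_le_totalDegree hH hall
  rw [hhom.totalDegree hH] at h1
  exact absurd h1 (not_le.2 (Nat.lt_mul_div_succ D (by omega)))

end Lines

end MvPolynomial

/-! ### Counting monomials and conditions. -/

/-- The exponents of the monomials of degree less than `k` in `n` variables. -/
noncomputable def exponentsBelow (n k : ℕ) : Finset (Fin n →₀ ℕ) :=
  (Finset.range k).biUnion fun j => Finset.univ.finsuppAntidiag j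

theorem mem_exponentsBelow {n k : ℕ} {α : Fin n →₀ ℕ} :
    α ∈ exponentsBelow n k ↔ α.degree < k := by
  simp [exponentsBelow, Finset.mem_finsuppAntidiag, Finsupp.degree_eq_sum]

theorem sum_range_multichoose (n k : ℕ) :
    ∑ j ∈ Finset.range (k + 1), n.multichoose j = (n + 1).multichoose k := by
  induction k with
  | zero => simp
  | succ k ih => rw [Finset.sum_range_succ, ih, Nat.multichoose_succ_succ, add_comm]

theorem card_exponentsBelow_succ (n k : ℕ) :
    (exponentsBelow n (k + 1)).card = (k + n).choose n := by
  rw [exponentsBelow, Finset.card_biUnion]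
  · simp only [Finset.card_finsuppAntidiag_nat_eq_multichoose, Finset.card_univ, Fintype.card_fin]
    rw [sum_range_multichoose, Nat.multichoose_eq, show n + 1 + k - 1 = k + n by omega,
      Nat.choose_symm_add]
  · intro i _ j _ hij
    rw [Function.onFun, Finset.disjoint_left]
    intro α hi hj
    rw [Finset.mem_finsuppAntidiag] at hi hj
    exact hij (hi.1.symm.trans hj.1)

/-- For `k + 1` in place of `k`, the left side is `(k + 1) ⋯ (k + n)`. This bound and the next one
compare each factor with the extreme ones. -/
theorem factorial_mul_card_exponentsBelow_le (n k : ℕ) :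
    n.factorial * (exponentsBelow n k).card ≤ (k + n) ^ n := by
  cases k with
  | zero => simp [exponentsBelow]
  | succ k =>
    rw [card_exponentsBelow_succ, ← Nat.ascFactorial_eq_factorial_mul_choose]
    exact (Nat.ascFactorial_le_pow_add k n).trans (Nat.pow_le_pow_left (by omega) n)

theorem pow_le_factorial_mul_card_exponentsBelow (n k : ℕ) :
    (k + 1) ^ n ≤ n.factorial * (exponentsBelow n (k + 1)).card := by
  rw [card_exponentsBelow_succ, ← Nat.ascFactorial_eq_factorial_mul_choose]
  exact Nat.pow_succ_le_ascFactorial _ _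

namespace MvPolynomial

/-- If there are more monomials of degree at most `d` than there are conditions, some nonzero
polynomial of degree at most `d` vanishes to prescribed orders. -/
theorem exists_ne_zero_vanishesAt {F : Type*} [Field F] [Fintype F] {n d : ℕ}
    (k : (Fin n → F) → ℕ)
    (hcard : ∑ x, (exponentsBelow n (k x)).card < (exponentsBelow n (d + 1)).card) :
    ∃ P : MvPolynomial (Fin n) F, P ≠ 0 ∧ P.totalDegree ≤ d ∧ ∀ x, P.VanishesAt x (k x) := by
  classical
  let comb : (exponentsBelow n (d + 1) → F) →ₗ[F] MvPolynomial (Fin n) F :=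
    Fintype.linearCombination F fun α => monomial α.1 (1 : F)
  let L : (exponentsBelow n (d + 1) → F) →ₗ[F] ((Σ x, exponentsBelow n (k x)) → F) :=
    LinearMap.pi fun s => (lcoeff F s.2.1).comp ((translate s.1).toLinearMap.comp comb)
  have hcomb : ∀ c, comb c = ∑ α, monomial α.1 (c α) := fun c => by
    simp [comb, Fintype.linearCombination_apply, smul_monomial]
  have hcoeff : ∀ c (α : exponentsBelow n (d + 1)), (comb c).coeff α = c α := fun c α => by
    rw [hcomb, coeff_sum, Finset.sum_eq_single α]
    · simp
    · intro β _ hβ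
      rw [coeff_monomial, if_neg fun h => hβ (Subtype.ext h)]
    · simp
  have hker : LinearMap.ker L ≠ ⊥ := by
    refine LinearMap.ker_ne_bot_of_finrank_lt ?_
    rw [Module.finrank_fintype_fun_eq_card, Module.finrank_fintype_fun_eq_card,
      Fintype.card_sigma]
    simpa using hcard
  obtain ⟨c, hc, hc0⟩ := Submodule.exists_mem_ne_zero_of_ne_bot hker
  refine ⟨comb c, fun h => hc0 ?_, ?_, fun x α hα => ?_⟩
  · funext α
    rw [← hcoeff c α, h, coeff_zero, Pi.zero_apply]
  · rw [hcomb]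
    refine totalDegree_finsetSum_le fun α _ => (totalDegree_monomial_le _ _).trans ?_
    have := mem_exponentsBelow.1 α.2
    exact Nat.lt_succ_iff.1 this
  · exact congrFun (LinearMap.mem_ker.1 hc) ⟨x, α, mem_exponentsBelow.2 hα⟩

end MvPolynomial

/-- For large `N`, `∑ x, (N g(x) + n) ^ n` is smaller than `(N B) ^ n` when `∑ x, g(x) ^ n` is
smaller than `B ^ n`. -/
theorem exists_sum_pow_lt {ι : Type*} [Fintype ι] (g : ι → ℝ) (n : ℕ) (B : ℝ)
    (h : ∑ x, g x ^ n < B ^ n) :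
    ∃ N : ℕ, 0 < N ∧ ∑ x, (N * g x + n) ^ n < (N * B) ^ n := by
  have hlim : Filter.Tendsto (fun N : ℕ => ∑ x, (g x + n / (N : ℝ)) ^ n) Filter.atTop
      (nhds (∑ x, (g x + 0) ^ n)) :=
    tendsto_finsetSum _ fun x _ =>
      (tendsto_const_nhds.add (tendsto_const_div_atTop_nhds_zero_nat _)).pow n
  simp only [add_zero] at hlim
  obtain ⟨N, hN, hN0⟩ := ((hlim.eventually_lt_const h).and (Filter.eventually_gt_atTop 0)).exists
  refine ⟨N, hN0, ?_⟩
  have hNpos : (0 : ℝ) < N := by exact_mod_cast hN0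
  calc ∑ x, (N * g x + n) ^ n = N ^ n * ∑ x, (g x + n / (N : ℝ)) ^ n := by
        rw [Finset.mul_sum]
        refine Finset.sum_congr rfl fun x _ => ?_
        rw [← mul_pow]
        congr 1
        field_simp
    _ < N ^ n * B ^ n := by gcongr
    _ = (N * B) ^ n := (mul_pow _ _ _).symm

/-- A line in the direction spanned by `v`, parametrized by the field. -/
theorem IsLineInDirection.exists_sum_eq {F : Type*} [Field F] [Fintype F] {n : ℕ}
    {E : AffineSubspace F (Fin n → F)} {v : Fin n → F} (hv : v ≠ 0)
    (hE : IsLineInDirection E (F ∙ v)) [DecidablePred fun x => x ∈ E] {M : Type*}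
    [AddCommMonoid M] (g : (Fin n → F) → M) :
    ∃ u, ∑ x ∈ Finset.univ.filter (fun x => x ∈ E), g x = ∑ t : F, g (u + t • v) := by
  obtain ⟨-, ⟨u, hu⟩, hdir⟩ := hE
  refine ⟨u, (Finset.sum_bij (fun t _ => u + t • v) ?_ ?_ ?_ fun _ _ => rfl).symm⟩
  · intro t _
    rw [Finset.mem_filter]
    refine ⟨Finset.mem_univ _, ?_⟩
    have : t • v +ᵥ u ∈ E := AffineSubspace.vadd_mem_of_mem_direction
      (hdir ▸ Submodule.smul_mem _ _ (Submodule.mem_span_singleton_self v)) hu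
    rwa [vadd_eq_add, add_comm] at this
  · intro s _ t _ hst
    exact smul_left_injective F hv (add_left_cancel hst)
  · intro x hx
    have h := AffineSubspace.vsub_mem_direction (Finset.mem_filter.1 hx).2 hu
    rw [hdir, Submodule.mem_span_singleton] at h
    obtain ⟨t, ht⟩ := h
    exact ⟨t, Finset.mem_univ _, by rw [ht, vsub_eq_sub, add_sub_cancel]⟩

/-! ### The choice of parameters and the conclusion. -/

theorem pow_le_sum_pow_of_rich_lines {F : Type*} [Field F] [Fintype F] {n : ℕ} [NeZero n] {r : ℕ}
    (hr : 0 < r) (g : (Fin n → F) → ℕ)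
    (hg : ∀ v : Fin n → F, v ≠ 0 → ∃ u, r ≤ ∑ t : F, g (u + t • v)) :
    (Fintype.card F * r) ^ n ≤ (2 * Fintype.card F - 1) ^ n * ∑ x, g x ^ n := by
  set q := Fintype.card F with hq
  have hq1 : 1 < q := Fintype.one_lt_card
  by_contra! h
  obtain ⟨N, hN0, hN⟩ := exists_sum_pow_lt (fun x => (((2 * q - 1) * g x : ℕ) : ℝ)) n
    ((q * r : ℕ) : ℝ) (by
      rw [Finset.mul_sum] at h
      simp only [← mul_pow] at h
      exact_mod_cast h)
  have hN' : ∑ x, (N * ((2 * q - 1) * g x) + n) ^ n < (N * (q * r)) ^ n := by exact_mod_cast hN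
  have hpos : 0 < N * (q * r) := by positivity
  -- With `d + 1 = N q r`, the sum of the orders on a rich line, times `q`, is at least `(2q - 1) (d
  -- + 1)`, just above the threshold `(2q - 1) d`.
  obtain ⟨d, hd⟩ := Nat.exists_eq_succ_of_ne_zero hpos.ne'
  obtain ⟨P, hP0, hPd, hPk⟩ := MvPolynomial.exists_ne_zero_vanishesAt (d := d)
    (fun x => N * ((2 * q - 1) * g x)) (by
      refine Nat.lt_of_mul_lt_mul_left (a := n.factorial) ?_
      rw [Finset.mul_sum]
      calc _ ≤ _ := Finset.sum_le_sum fun x _ => factorial_mul_card_exponentsBelow_le n _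
        _ < _ := hN'
        _ = (d + 1) ^ n := by rw [hd]
        _ ≤ _ := pow_le_factorial_mul_card_exponentsBelow n d)
  refine hP0 (MvPolynomial.eq_zero_of_vanishesAt_lines hPd _ hPk fun v hv => ?_)
  obtain ⟨u, hu⟩ := hg v hv
  refine ⟨u, ?_⟩
  rw [← hq, ← Finset.mul_sum, ← Finset.mul_sum]
  calc d * (2 * q - 1) < (d + 1) * (2 * q - 1) :=
        Nat.mul_lt_mul_of_pos_right (Nat.lt_succ_self d) (by omega)
    _ = q * (N * ((2 * q - 1) * r)) := by rw [← Nat.succ_eq_add_one, ← hd]; ring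
    _ ≤ _ := by gcongr

open Classical in
theorem mainTheorem3 {F : Type*} [Field F] [Fintype F] (n : ℕ) (r : ℕ) (f : (Fin n → F) → ℤ)
    (hf : ∀ W : Submodule F (Fin n → F), Module.finrank F W = 1 →
      ∃ E : AffineSubspace F (Fin n → F), IsLineInDirection E W ∧
        (r : ℤ) ≤ ∑ x ∈ Finset.univ.filter (fun x => x ∈ E), |f x|) :
    (r : ℝ) ^ n / (2 - (Fintype.card F : ℝ)⁻¹) ^ n ≤ ∑ x : Fin n → F, |(f x : ℝ)| ^ n := by
  rcases Nat.eq_zero_or_pos n with rfl | hn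
  · simp
  have : NeZero n := ⟨hn.ne'⟩
  rcases Nat.eq_zero_or_pos r with rfl | hr
  · rw [Nat.cast_zero, zero_pow hn.ne', zero_div]
    positivity
  have hmain := pow_le_sum_pow_of_rich_lines hr (fun x => (f x).natAbs) fun v hv => by
    obtain ⟨E, hE, hle⟩ := hf (F ∙ v) (finrank_span_singleton hv)
    obtain ⟨u, hu⟩ := hE.exists_sum_eq hv fun x => |f x|
    refine ⟨u, ?_⟩
    rw [hu] at hle
    zify
    exact hle
  have hq1 : 1 < Fintype.card F := Fintype.one_lt_card
  have hq : (1 : ℝ) < Fintype.card F := by exact_mod_cast hq1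
  have hcast : ((Fintype.card F : ℝ) * r) ^ n ≤
      (2 * (Fintype.card F : ℝ) - 1) ^ n * ∑ x, |(f x : ℝ)| ^ n := by
    have h : (((Fintype.card F * r) ^ n : ℕ) : ℝ) ≤ _ := Nat.cast_le.2 hmain
    push_cast [Nat.cast_sub (by omega : 1 ≤ 2 * Fintype.card F)] at h
    simpa only [Nat.cast_natAbs, Int.cast_abs] using h
  rw [show 2 - (Fintype.card F : ℝ)⁻¹ = (2 * Fintype.card F - 1) / Fintype.card F by field_simp,
    div_pow, div_div_eq_mul_div, ← mul_pow, mul_comm, div_le_iff₀' (pow_pos (by linarith) n)]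
  exact hcast
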